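/- Let $\alpha>-1$, $\lambda\ge 0$, $\nu\ge 0$ and $t>0$. Let $\rho_\nu(x)=2x^{\nu/2}K_\nu(2\sqrt x)$, $x>0$, where $K_\nu$ is the modified Bessel function of the second kind, and let $\{P_n\}_{n\ge0}$, $P_n(x)=P_n(x;\lambda,t)$, be a sequence of real polynomials with $\deg P_n=n$ that is orthonormal with respect to the weight $e^{-\lambda x}\rho_\nu(xt)x^\alpha$ on $(0,\infty)$: $$\int_0^\infty P_m(x)P_n(x)e^{-\lambda x}\rho_\nu(xt)x^\alpha\,dx=\delta_{n,m},\qquad n,m\in\mathbb N_0 .$$ Let $\theta=yDy$, $D=d/dy$, i.e. $(\theta f)(y)=y\,\frac{d}{dy}\bigl(yf(y)\bigr)$, and for a polynomial $p(x)=\sum_k p_kx^k$ put $p(\theta/t)=\sum_k p_kt^{-k}\theta^k$, where $\theta^k$ is the $k$-fold composition. Then the sequence $\{P_n\}$ is compositionally orthogonal in the sense of Laguerre: for every $n\ge1$ and every $m=0,1,\dots,n-1$, $$\int_0^\infty y^\nu e^{-y}\,P_n\!\left(\frac{\theta}{t}\right)\theta^m\left\{\frac{\Gamma(1+\alpha)\,y^\alpha}{(\lambda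 y+t)^{\alpha+1}}\right\}dy=0,$$ where the integral converges absolutely. Moreover, these conditions are the usual orthogonality conditions in another form: for every $n\ge1$ and every real polynomial $p$ of degree $n$, one has $\int_0^\infty p(x)e^{-\lambda x}\rho_\nu(xt)x^{\alpha+m}\,dx=0$ for all $m=0,\dots,n-1$ if and only if $\int_0^\infty y^\nu e^{-y}\,p(\theta/t)\,\theta^m\{\Gamma(1+\alpha)y^\alpha(\lambda y+t)^{-\alpha-1}\}\,dy=0$ for all $m=0,\dots,n-1$, where all integrals converge absolutely. -/

import Mathlib

open MeasureTheory Set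
open scoped Polynomial

noncomputable section

/-- The modified Bessel function of the second kind (Macdonald function) `K_ν(z)`, for real `ν`
and `z > 0`, as `∫₀^∞ exp (-z cosh u) cosh (ν u) du`. -/
def macdonaldK (ν z : ℝ) : ℝ :=
  ∫ u in Ioi (0 : ℝ), Real.exp (-(z * Real.cosh u)) * Real.cosh (ν * u)

/-- The scaled Macdonald function `ρ_ν(x) = 2 x^{ν/2} K_ν(2 √x)`, `x > 0`. -/
def macdonaldRho (ν x : ℝ) : ℝ :=
  2 * x ^ (ν / 2) * macdonaldK ν (2 * Real.sqrt x)

/-- The weight `e^{-λ x} ρ_ν(x t) x^α` on `(0, ∞)`. -/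
def orthoWeight (α ν lam t x : ℝ) : ℝ :=
  Real.exp (-(lam * x)) * macdonaldRho ν (x * t) * x ^ α

/-- `P` is a sequence of orthonormal polynomials for the weight, `P n` of degree exactly `n`. -/
structure IsOrthonormalSeq (α ν lam t : ℝ) (P : ℕ → ℝ[X]) : Prop where
  degree_eq : ∀ n, (P n).degree = (n : WithBot ℕ)
  integral_eq : ∀ m n,
    ∫ x in Ioi (0 : ℝ), (P m).eval x * (P n).eval x * orthoWeight α ν lam t x
      = if n = m then 1 else 0

/-- `p` is orthogonal to `1, x, …, x^{n-1}` with respect to the weight. -/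
def OrthogonalToLower (α ν lam t : ℝ) (n : ℕ) (p : ℝ[X]) : Prop :=
  ∀ m < n,
    IntegrableOn (fun x => p.eval x * orthoWeight α ν lam t x * x ^ m) (Ioi (0 : ℝ)) ∧
    ∫ x in Ioi (0 : ℝ), p.eval x * orthoWeight α ν lam t x * x ^ m = 0

/-- The operator `θ = y D y`, that is `(θ f)(y) = y (d/dy)(y f(y))`. -/
def thetaOp (f : ℝ → ℝ) : ℝ → ℝ :=
  fun y => y * deriv (fun z => z * f z) y

/-- The operator polynomial `p(A) = ∑ₖ pₖ Aᵏ`, where `Aᵏ` is the `k`-fold composition. -/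
def polyOp (p : ℝ[X]) (A : (ℝ → ℝ) → (ℝ → ℝ)) (f : ℝ → ℝ) : ℝ → ℝ :=
  fun y => ∑ k ∈ Finset.range (p.natDegree + 1), p.coeff k * (A^[k] f) y

/-- The function `Γ(1+α) y^α / (λ y + t)^{α+1}`, `y > 0`. -/
def laguerreKernel (α lam t : ℝ) : ℝ → ℝ :=
  fun y => Real.Gamma (1 + α) * y ^ α / (lam * y + t) ^ (α + 1)

/-- The integrand `y^ν e^{-y} p(θ/t) θ^m {Γ(1+α) y^α / (λ y + t)^{α+1}}`. -/
def compositionIntegrand (α ν lam t : ℝ) (p : ℝ[X]) (m : ℕ) : ℝ → ℝ :=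
  fun y => y ^ ν * Real.exp (-y) *
    polyOp p (fun f => (1 / t) • thetaOp f) (thetaOp^[m] (laguerreKernel α lam t)) y

/-- The composition orthogonality conditions in the sense of Laguerre for a polynomial `p`
and the exponents `m = 0, …, n-1`: the integrals converge absolutely and vanish. -/
def CompositionallyOrthogonal (α ν lam t : ℝ) (n : ℕ) (p : ℝ[X]) : Prop :=
  ∀ m < n,
    IntegrableOn (compositionIntegrand α ν lam t p m) (Ioi (0 : ℝ)) ∧
    ∫ y in Ioi (0 : ℝ), compositionIntegrand α ν lam t p m y = 0

end

/-
The Laplace transform `∫ x^b e^{-(λ + t/y) x} dx` over `x > 0` is `y` times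
`κ_b(y) = Γ(1+b) y^b (λ y + t)^{-b-1}`, while `ρ_ν(x) = ∫ y^{ν-1} e^{-y-x/y} dy` over `y > 0`.
Fubini therefore identifies the integral of the weight `e^{-λ x} ρ_ν(x t) x^b` with the integral of
`y^ν e^{-y} κ_b(y)`. Since `θ κ_b = t κ_{b+1}`, applying `θ/t` in the variable `y` amounts to
multiplying by `x` under the transform, so the `m`-th compositional integral of `p` is `t^m` times
the integral of `p(x) x^m` against the weight.
-/

section LinearFunctionals

theorem linearMap_eq_zero_of_degree_lt {R M : Type*} [Ring R] [AddCommGroup M] [Module R M]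
    (S : Polynomial.Sequence R) {n : ℕ} (hS : ∀ i < n, IsUnit (S i).leadingCoeff)
    (L : R[X] →ₗ[R] M) (hL : ∀ i < n, L (S i) = 0) {q : R[X]} (hq : q.degree < n) : L q = 0 := by
  have hmem : q ∈ Submodule.span R (S '' Iio n) := by
    rwa [S.span_degreeLT hS, Polynomial.mem_degreeLT]
  refine LinearMap.eqOn_span (g := 0) ?_ hmem
  rintro _ ⟨i, hi, rfl⟩
  exact hL i hi

variable {μ : Measure ℝ} {w : ℝ → ℝ}

theorem integrable_eval_mul (hw : ∀ k : ℕ, Integrable (fun x => x ^ k * w x) μ) (p : ℝ[X]) :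
    Integrable (fun x => p.eval x * w x) μ := by
  simp only [Polynomial.eval_eq_sum_range, Finset.sum_mul, mul_assoc]
  exact integrable_finsetSum _ fun k _ => (hw k).const_mul _

theorem integrable_eval_mul_mul_pow (hw : ∀ k : ℕ, Integrable (fun x => x ^ k * w x) μ)
    (p : ℝ[X]) (m : ℕ) : Integrable (fun x => p.eval x * w x * x ^ m) μ := by
  have heval (x : ℝ) : p.eval x * w x * x ^ m = (p * Polynomial.X ^ m).eval x * w x := by
    rw [Polynomial.eval_mul, Polynomial.eval_pow, Polynomial.eval_X, mul_right_comm]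
  simpa only [heval] using integrable_eval_mul hw (p * Polynomial.X ^ m)

theorem integral_eval_mul_mul_pow_eq_sum (hw : ∀ k : ℕ, Integrable (fun x => x ^ k * w x) μ)
    (p : ℝ[X]) (m : ℕ) :
    ∫ x, p.eval x * w x * x ^ m ∂μ
      = ∑ k ∈ Finset.range (p.natDegree + 1), p.coeff k * ∫ x, x ^ (k + m) * w x ∂μ := by
  have hsum (x : ℝ) : p.eval x * w x * x ^ m
      = ∑ k ∈ Finset.range (p.natDegree + 1), p.coeff k * (x ^ (k + m) * w x) := by
    simp only [Polynomial.eval_eq_sum_range, Finset.sum_mul]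
    exact Finset.sum_congr rfl fun k _ => by ring
  simp only [hsum]
  rw [integral_finsetSum _ fun k _ => (hw (k + m)).const_mul _]
  simp only [integral_const_mul]

/-- The moment functional `p ↦ ∫ p w dμ` on real polynomials, for a weight `w` all of whose moments
converge absolutely. It turns orthogonality of polynomials into linear algebra. -/
noncomputable def momentFunctional (hw : ∀ k : ℕ, Integrable (fun x => x ^ k * w x) μ) :
    ℝ[X] →ₗ[ℝ] ℝ where
  toFun p := ∫ x, p.eval x * w x ∂μ
  map_add' p q := by
    simp only [Polynomial.eval_add, add_mul]
    exact integral_add (integrable_eval_mul hw p) (integrable_eval_mul hw q)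
  map_smul' c p := by
    simp only [Polynomial.eval_smul, smul_eq_mul, mul_assoc, integral_const_mul, RingHom.id_apply]

theorem momentFunctional_apply (hw : ∀ k : ℕ, Integrable (fun x => x ^ k * w x) μ) (p : ℝ[X]) :
    momentFunctional hw p = ∫ x, p.eval x * w x ∂μ :=
  rfl

end LinearFunctionals

section ExponentialSubstitution

variable {E : Type*} [NormedAddCommGroup E] [NormedSpace ℝ E] {c : ℝ}

theorem image_const_mul_exp_univ (hc : 0 < c) : (fun u => c * Real.exp u) '' univ = Ioi 0 := by
  rw [image_univ, range_comp' (c * ·) Real.exp, Real.range_exp, image_mul_left_Ioi hc, mul_zero]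

theorem injOn_const_mul_exp (hc : 0 < c) : InjOn (fun u => c * Real.exp u) univ :=
  ((mul_right_injective₀ hc.ne').comp Real.exp_injective).injOn

theorem hasDerivWithinAt_const_mul_exp (c : ℝ) (s : Set ℝ) (u : ℝ) :
    HasDerivWithinAt (fun u => c * Real.exp u) (c * Real.exp u) s u :=
  ((Real.hasDerivAt_exp u).const_mul c).hasDerivWithinAt

theorem integral_Ioi_eq_integral_comp_const_mul_exp (hc : 0 < c) (f : ℝ → E) :
    ∫ y in Ioi 0, f y = ∫ u, (c * Real.exp u) • f (c * Real.exp u) := by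
  have hpos (u : ℝ) : 0 < c * Real.exp u := by positivity
  rw [← image_const_mul_exp_univ hc, integral_image_eq_integral_abs_deriv_smul MeasurableSet.univ
    (fun u _ => hasDerivWithinAt_const_mul_exp c univ u) (injOn_const_mul_exp hc)]
  simp only [abs_of_pos (hpos _), Measure.restrict_univ]

theorem integrableOn_Ioi_iff_integrable_comp_const_mul_exp (hc : 0 < c) (f : ℝ → E) :
    IntegrableOn f (Ioi 0) ↔ Integrable fun u => (c * Real.exp u) • f (c * Real.exp u) := by
  have hpos (u : ℝ) : 0 < c * Real.exp u := by positivity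
  rw [← image_const_mul_exp_univ hc,
    integrableOn_image_iff_integrableOn_abs_deriv_smul MeasurableSet.univ
      (fun u _ => hasDerivWithinAt_const_mul_exp c univ u) (injOn_const_mul_exp hc)]
  simp only [abs_of_pos (hpos _), integrableOn_univ]

theorem integral_eq_integral_Ioi_add_comp_neg {f : ℝ → E} (hf : Integrable f) :
    ∫ u, f u = ∫ u in Ioi 0, (f u + f (-u)) := by
  have hneg := integral_comp_neg_Ioi 0 f
  rw [neg_zero] at hneg
  rw [integral_add hf.integrableOn hf.comp_neg.integrableOn, hneg, add_comm,
    intervalIntegral.integral_Iic_add_Ioi hf.integrableOn hf.integrableOn]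

end ExponentialSubstitution

section MacdonaldFunction

theorem integrableOn_rpow_mul_exp_neg {s : ℝ} (hs : -1 < s) :
    IntegrableOn (fun y : ℝ => y ^ s * Real.exp (-y)) (Ioi 0) := by
  simpa using integrableOn_rpow_mul_exp_neg_mul_rpow hs one_pos one_pos

theorem exp_neg_div_le_factorial_mul_pow {x y : ℝ} (hx : 0 < x) (hy : 0 < y) (n : ℕ) :
    Real.exp (-(x / y)) ≤ n.factorial / x ^ n * y ^ n := by
  have h := inv_anti₀ (by positivity) (Real.pow_div_factorial_le_exp (x / y) (by positivity) n)
  rw [← Real.exp_neg, inv_div, div_pow, div_div_eq_mul_div] at h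
  rwa [div_mul_eq_mul_div]

theorem integrableOn_rpow_mul_exp_neg_add_div (s : ℝ) {x : ℝ} (hx : 0 < x) :
    IntegrableOn (fun y : ℝ => y ^ s * Real.exp (-(y + x / y))) (Ioi 0) := by
  obtain ⟨n, hn⟩ := exists_nat_gt (-s - 1)
  refine Integrable.mono' ((integrableOn_rpow_mul_exp_neg (by linarith : -1 < s + n)).const_mul
    (n.factorial / x ^ n)) (Measurable.aestronglyMeasurable (by fun_prop)) ?_
  filter_upwards [ae_restrict_mem measurableSet_Ioi] with y (hy : 0 < y)
  rw [Real.norm_of_nonneg (by positivity), neg_add, Real.exp_add]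
  calc y ^ s * (Real.exp (-y) * Real.exp (-(x / y)))
      ≤ y ^ s * (Real.exp (-y) * (n.factorial / x ^ n * y ^ n)) := by
        gcongr
        exact exp_neg_div_le_factorial_mul_pow hx hy n
    _ = n.factorial / x ^ n * (y ^ (s + n) * Real.exp (-y)) := by
        rw [Real.rpow_add_natCast hy.ne']
        ring

theorem rpow_mul_exp_neg_add_sq_div_comp_const_mul_exp (ν : ℝ) {c : ℝ} (hc : 0 < c) (u : ℝ) :
    (c * Real.exp u) • ((c * Real.exp u) ^ (ν - 1) *
        Real.exp (-(c * Real.exp u + c ^ 2 / (c * Real.exp u))))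
      = c ^ ν * (Real.exp (-(2 * c * Real.cosh u)) * Real.exp (ν * u)) := by
  have hexponent : c * Real.exp u + c ^ 2 / (c * Real.exp u) = 2 * c * Real.cosh u := by
    rw [Real.cosh_eq, Real.exp_neg]
    field_simp
  have hpower : c * Real.exp u * (c * Real.exp u) ^ (ν - 1) = c ^ ν * Real.exp (ν * u) := by
    rw [mul_comm, ← Real.rpow_add_one (by positivity), sub_add_cancel,
      Real.mul_rpow hc.le (Real.exp_pos u).le, ← Real.exp_mul, mul_comm u ν]
  rw [hexponent, smul_eq_mul, ← mul_assoc, hpower]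
  ring

theorem integrable_exp_neg_mul_cosh_mul_exp (ν : ℝ) {z : ℝ} (hz : 0 < z) :
    Integrable fun u => Real.exp (-(z * Real.cosh u)) * Real.exp (ν * u) := by
  have hc : 0 < z / 2 := half_pos hz
  have h := integrableOn_rpow_mul_exp_neg_add_div (ν - 1) (x := (z / 2) ^ 2) (by positivity)
  rw [integrableOn_Ioi_iff_integrable_comp_const_mul_exp hc] at h
  simp only [rpow_mul_exp_neg_add_sq_div_comp_const_mul_exp ν hc, mul_div_cancel₀ z two_ne_zero]
    at h
  exact (integrable_const_mul_iff (Real.rpow_pos_of_pos hc ν).ne'.isUnit _).1 h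

theorem integral_exp_neg_mul_cosh_mul_exp (ν : ℝ) {z : ℝ} (hz : 0 < z) :
    ∫ u, Real.exp (-(z * Real.cosh u)) * Real.exp (ν * u) = 2 * macdonaldK ν z := by
  rw [integral_eq_integral_Ioi_add_comp_neg (integrable_exp_neg_mul_cosh_mul_exp ν hz),
    macdonaldK, ← integral_const_mul]
  refine integral_congr_ae (.of_forall fun u => ?_)
  beta_reduce
  rw [Real.cosh_neg, Real.cosh_eq (ν * u), mul_neg]
  ring

theorem integral_rpow_mul_exp_neg_add_sq_div (ν : ℝ) {c : ℝ} (hc : 0 < c) :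
    ∫ y in Ioi (0 : ℝ), y ^ (ν - 1) * Real.exp (-(y + c ^ 2 / y))
      = 2 * c ^ ν * macdonaldK ν (2 * c) := by
  rw [integral_Ioi_eq_integral_comp_const_mul_exp hc]
  simp only [rpow_mul_exp_neg_add_sq_div_comp_const_mul_exp ν hc]
  rw [integral_const_mul, integral_exp_neg_mul_cosh_mul_exp ν (by positivity)]
  ring

theorem macdonaldRho_eq_integral (ν : ℝ) {x : ℝ} (hx : 0 < x) :
    macdonaldRho ν x = ∫ y in Ioi (0 : ℝ), y ^ (ν - 1) * Real.exp (-(y + x / y)) := by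
  have h := integral_rpow_mul_exp_neg_add_sq_div ν (Real.sqrt_pos.2 hx)
  rw [Real.sq_sqrt hx.le] at h
  rw [h, macdonaldRho, Real.rpow_div_two_eq_sqrt ν hx.le]

end MacdonaldFunction

section LaguerreKernel

variable {b lam t y : ℝ}

theorem laguerreKernel_eq_mul_div_rpow (b : ℝ) (hy : 0 < y) (hlt : 0 < lam * y + t) :
    y * laguerreKernel b lam t y = Real.Gamma (1 + b) * (y / (lam * y + t)) ^ (b + 1) := by
  rw [laguerreKernel, Real.div_rpow hy.le hlt.le, Real.rpow_add_one hy.ne']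
  ring

theorem integral_rpow_mul_exp_neg_add_div_mul (hb : -1 < b) (hy : 0 < y)
    (hlt : 0 < lam * y + t) :
    ∫ x in Ioi (0 : ℝ), x ^ b * Real.exp (-((lam + t / y) * x)) = y * laguerreKernel b lam t y := by
  have hrate : lam + t / y = (lam * y + t) / y := by field_simp
  have h := Real.integral_rpow_mul_exp_neg_mul_Ioi (a := b + 1) (r := lam + t / y) (by linarith)
    (hrate ▸ div_pos hlt hy)
  rw [add_sub_cancel_right] at h
  rw [h, hrate, one_div_div, laguerreKernel_eq_mul_div_rpow b hy hlt, add_comm 1 b, mul_comm]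

theorem laguerreKernel_nonneg (hb : -1 ≤ b) (hy : 0 ≤ y) (hlt : 0 ≤ lam * y + t) :
    0 ≤ laguerreKernel b lam t y := by
  have hΓ : 0 ≤ Real.Gamma (1 + b) := Real.Gamma_nonneg_of_nonneg (by linarith)
  unfold laguerreKernel
  positivity

theorem laguerreKernel_le (hb : -1 ≤ b) (hlam : 0 ≤ lam) (ht : 0 < t) (hy : 0 ≤ y) :
    laguerreKernel b lam t y ≤ Real.Gamma (1 + b) / t ^ (b + 1) * y ^ b := by
  have hΓ : 0 ≤ Real.Gamma (1 + b) := Real.Gamma_nonneg_of_nonneg (by linarith)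
  have hle : t ^ (b + 1) ≤ (lam * y + t) ^ (b + 1) :=
    Real.rpow_le_rpow ht.le (le_add_of_nonneg_left (by positivity)) (by linarith)
  rw [div_mul_eq_mul_div, laguerreKernel]
  gcongr

theorem integrableOn_rpow_mul_exp_neg_mul_laguerreKernel {ν : ℝ} (hb : -1 ≤ b)
    (hbν : -1 < b + ν) (hlam : 0 ≤ lam) (ht : 0 < t) :
    IntegrableOn (fun y => y ^ ν * Real.exp (-y) * laguerreKernel b lam t y) (Ioi 0) := by
  have hmeas : Measurable fun y => y ^ ν * Real.exp (-y) * laguerreKernel b lam t y := by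
    unfold laguerreKernel
    fun_prop
  refine Integrable.mono' ((integrableOn_rpow_mul_exp_neg hbν).const_mul
    (Real.Gamma (1 + b) / t ^ (b + 1))) hmeas.aestronglyMeasurable ?_
  filter_upwards [ae_restrict_mem measurableSet_Ioi] with y (hy : 0 < y)
  have hnonneg : 0 ≤ laguerreKernel b lam t y := laguerreKernel_nonneg hb hy.le (by positivity)
  rw [Real.norm_of_nonneg (by positivity)]
  calc y ^ ν * Real.exp (-y) * laguerreKernel b lam t y
      ≤ y ^ ν * Real.exp (-y) * (Real.Gamma (1 + b) / t ^ (b + 1) * y ^ b) := by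
        gcongr
        exact laguerreKernel_le hb hlam ht hy.le
    _ = Real.Gamma (1 + b) / t ^ (b + 1) * (y ^ (b + ν) * Real.exp (-y)) := by
        rw [Real.rpow_add hy]
        ring

end LaguerreKernel

section Fubini

/-- The joint density `y^{ν-1} e^{-y} x^b e^{-(λ + t/y) x}` on the open quadrant. Its marginals are
the weight `e^{-λ x} ρ_ν(x t) x^b` and the function `y^ν e^{-y} Γ(1+b) y^b (λ y + t)^{-b-1}`; as a
function of `x` it is kept in the form of a Laplace integrand. -/
noncomputable def jointDensity (b ν lam t x y : ℝ) : ℝ :=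
  y ^ (ν - 1) * Real.exp (-y) * (x ^ b * Real.exp (-((lam + t / y) * x)))

variable {b ν lam t : ℝ}

theorem integral_jointDensity_snd (b ν lam : ℝ) {x : ℝ} (hxt : 0 < x * t) :
    ∫ y in Ioi 0, jointDensity b ν lam t x y = orthoWeight b ν lam t x := by
  rw [orthoWeight, macdonaldRho_eq_integral ν hxt, mul_right_comm, ← integral_const_mul]
  refine integral_congr_ae (.of_forall fun y => ?_)
  beta_reduce
  rw [jointDensity, show -((lam + t / y) * x) = -(lam * x) + -(x * t / y) by ring, neg_add,
    Real.exp_add, Real.exp_add]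
  ring

theorem integral_jointDensity_fst (ν : ℝ) {y : ℝ} (hb : -1 < b) (hy : 0 < y)
    (hlt : 0 < lam * y + t) :
    ∫ x in Ioi 0, jointDensity b ν lam t x y
      = y ^ ν * Real.exp (-y) * laguerreKernel b lam t y := by
  have hpow : y ^ ν = y ^ (ν - 1) * y := by rw [← Real.rpow_add_one hy.ne', sub_add_cancel]
  simp only [jointDensity]
  rw [integral_const_mul, integral_rpow_mul_exp_neg_add_div_mul hb hy hlt, hpow]
  ring

theorem jointDensity_nonneg (b ν lam t : ℝ) {x y : ℝ} (hx : 0 ≤ x) (hy : 0 ≤ y) :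
    0 ≤ jointDensity b ν lam t x y := by
  unfold jointDensity
  positivity

theorem integrableOn_jointDensity_fst (ν : ℝ) {y : ℝ} (hb : -1 < b) (hrate : 0 < lam + t / y) :
    IntegrableOn (fun x => jointDensity b ν lam t x y) (Ioi 0) := by
  have h := integrableOn_rpow_mul_exp_neg_mul_rpow hb one_pos hrate
  simp only [Real.rpow_one, neg_mul] at h
  exact Integrable.const_mul h _

variable (hb : -1 < b) (hbν : -1 < b + ν) (hlam : 0 ≤ lam) (ht : 0 < t)
include hb hbν hlam ht

theorem integrable_jointDensity :
    Integrable (Function.uncurry (jointDensity b ν lam t))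
      ((volume.restrict (Ioi 0)).prod (volume.restrict (Ioi 0))) := by
  have hmeas : Measurable (Function.uncurry (jointDensity b ν lam t)) := by
    unfold Function.uncurry jointDensity
    fun_prop
  refine (integrable_prod_iff' hmeas.aestronglyMeasurable).2 ⟨?_, ?_⟩
  · filter_upwards [ae_restrict_mem measurableSet_Ioi] with y (hy : 0 < y)
    exact integrableOn_jointDensity_fst ν hb (by positivity)
  · refine (integrableOn_rpow_mul_exp_neg_mul_laguerreKernel hb.le hbν hlam ht).congr_fun ?_
      measurableSet_Ioi
    intro y (hy : 0 < y)
    have hnorm : EqOn (fun x => ‖jointDensity b ν lam t x y‖)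
        (fun x => jointDensity b ν lam t x y) (Ioi 0) := fun x (hx : 0 < x) =>
      Real.norm_of_nonneg (jointDensity_nonneg b ν lam t hx.le hy.le)
    exact ((setIntegral_congr_fun measurableSet_Ioi hnorm).trans
      (integral_jointDensity_fst ν hb hy (by positivity))).symm

theorem integrableOn_orthoWeight : IntegrableOn (orthoWeight b ν lam t) (Ioi 0) :=
  IntegrableOn.congr_fun (integrable_jointDensity hb hbν hlam ht).integral_prod_left
    (fun _ hx => integral_jointDensity_snd b ν lam (mul_pos hx ht)) measurableSet_Ioi

theorem integral_orthoWeight :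
    ∫ x in Ioi 0, orthoWeight b ν lam t x
      = ∫ y in Ioi 0, y ^ ν * Real.exp (-y) * laguerreKernel b lam t y :=
  calc ∫ x in Ioi 0, orthoWeight b ν lam t x
      = ∫ x in Ioi 0, ∫ y in Ioi 0, jointDensity b ν lam t x y :=
        setIntegral_congr_fun measurableSet_Ioi fun _ hx =>
          (integral_jointDensity_snd b ν lam (mul_pos hx ht)).symm
    _ = ∫ y in Ioi 0, ∫ x in Ioi 0, jointDensity b ν lam t x y :=
        integral_integral_swap (integrable_jointDensity hb hbν hlam ht)
    _ = ∫ y in Ioi 0, y ^ ν * Real.exp (-y) * laguerreKernel b lam t y :=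
        setIntegral_congr_fun measurableSet_Ioi fun y (hy : 0 < y) =>
          integral_jointDensity_fst ν hb hy (by positivity)

end Fubini

section ThetaOperator

theorem thetaOp_congr {f g : ℝ → ℝ} {s : Set ℝ} (hs : IsOpen s) (h : EqOn f g s) :
    EqOn (thetaOp f) (thetaOp g) s := by
  intro y hy
  have hev : (fun z => z * f z) =ᶠ[nhds y] fun z => z * g z := by
    filter_upwards [hs.mem_nhds hy] with z hz
    rw [h hz]
  rw [thetaOp, thetaOp, hev.deriv_eq]

theorem thetaOp_const_smul (c : ℝ) (f : ℝ → ℝ) : thetaOp (c • f) = c • thetaOp f := by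
  funext y
  have h : (fun z => z * (c • f) z) = fun z => c * (z * f z) := by
    funext z
    rw [Pi.smul_apply, smul_eq_mul, mul_left_comm]
  rw [thetaOp, h, deriv_const_mul_field', Pi.smul_apply, smul_eq_mul, thetaOp, mul_left_comm]

theorem iterate_const_smul_thetaOp (c : ℝ) (k : ℕ) (f : ℝ → ℝ) :
    (fun f => c • thetaOp f)^[k] f = c ^ k • thetaOp^[k] f := by
  have hcomm : Function.Commute (c • · : (ℝ → ℝ) → ℝ → ℝ) thetaOp := fun f =>
    (thetaOp_const_smul c f).symm
  rw [show (fun f => c • thetaOp f) = (c • · : (ℝ → ℝ) → ℝ → ℝ) ∘ thetaOp from rfl,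
    hcomm.comp_iterate, smul_iterate, Function.comp_apply]

theorem thetaOp_laguerreKernel {b lam t y : ℝ} (hb : b ≠ -1) (hy : 0 < y)
    (hlt : 0 < lam * y + t) :
    thetaOp (laguerreKernel b lam t) y = t * laguerreKernel (b + 1) lam t y := by
  have hev : (fun z => z * laguerreKernel b lam t z) =ᶠ[nhds y]
      fun z => Real.Gamma (1 + b) * (z / (lam * z + t)) ^ (b + 1) := by
    have hcont : Continuous fun z => lam * z + t := by fun_prop
    filter_upwards [Ioi_mem_nhds hy, hcont.continuousAt.eventually_const_lt hlt] with z hz hzt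
    exact laguerreKernel_eq_mul_div_rpow b hz hzt
  have hquot : HasDerivAt (fun z => z / (lam * z + t)) (t / (lam * y + t) ^ 2) y :=
    ((hasDerivAt_id' y).div (((hasDerivAt_id' y).const_mul lam).add_const t) hlt.ne').congr_deriv
      (by ring)
  have hderiv := (hquot.rpow_const (p := b + 1) (Or.inl (by positivity))).const_mul
    (Real.Gamma (1 + b))
  have hΓ : Real.Gamma (1 + (b + 1)) = (1 + b) * Real.Gamma (1 + b) := by
    rw [← add_assoc, Real.Gamma_add_one fun h => hb (by linarith)]
  rw [thetaOp, hev.deriv_eq, hderiv.deriv, laguerreKernel, hΓ, add_sub_cancel_right,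
    Real.div_rpow hy.le hlt.le, Real.rpow_add_one hy.ne', Real.rpow_add_one hlt.ne',
    Real.rpow_add_one hlt.ne']
  field_simp
  ring

theorem iterate_thetaOp_laguerreKernel {b lam t : ℝ} (hb : -1 < b) (hlam : 0 ≤ lam) (ht : 0 < t)
    (k : ℕ) :
    EqOn (thetaOp^[k] (laguerreKernel b lam t)) (t ^ k • laguerreKernel (b + k) lam t) (Ioi 0) := by
  induction k with
  | zero => simp [eqOn_refl]
  | succ k ih =>
    intro y (hy : 0 < y)
    have hbk : -1 < b + k := by linarith [k.cast_nonneg (α := ℝ)]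
    rw [Function.iterate_succ_apply', thetaOp_congr isOpen_Ioi ih hy, thetaOp_const_smul,
      Pi.smul_apply, thetaOp_laguerreKernel hbk.ne' hy (by positivity), Pi.smul_apply, smul_eq_mul,
      smul_eq_mul, pow_succ, mul_assoc, Nat.cast_add_one, add_assoc]

theorem compositionIntegrand_eq_sum {α lam t : ℝ} (hα : -1 < α) (ν : ℝ) (hlam : 0 ≤ lam)
    (ht : 0 < t) (p : ℝ[X]) (m : ℕ) :
    EqOn (compositionIntegrand α ν lam t p m) (fun y => ∑ k ∈ Finset.range (p.natDegree + 1),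
      t ^ m * p.coeff k * (y ^ ν * Real.exp (-y) * laguerreKernel (α + (k + m : ℕ)) lam t y))
      (Ioi 0) := by
  intro y hy
  simp only [compositionIntegrand, polyOp, Finset.mul_sum]
  refine Finset.sum_congr rfl fun k _ => ?_
  have hterm : ((fun f => (1 / t) • thetaOp f)^[k] (thetaOp^[m] (laguerreKernel α lam t))) y
      = t ^ m * laguerreKernel (α + (k + m : ℕ)) lam t y := by
    rw [iterate_const_smul_thetaOp, ← Function.iterate_add_apply, Pi.smul_apply,
      iterate_thetaOp_laguerreKernel hα hlam ht (k + m) hy, Pi.smul_apply, smul_eq_mul,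
      smul_eq_mul, pow_add, ← mul_assoc, ← mul_assoc, ← mul_pow, one_div_mul_cancel ht.ne', one_pow,
      one_mul]
  rw [hterm]
  ring

end ThetaOperator

section CompositionOrthogonality

variable {α ν lam t : ℝ} (hα : -1 < α) (hαν : -1 < α + ν) (hlam : 0 ≤ lam) (ht : 0 < t)

theorem pow_mul_orthoWeight (α ν lam t : ℝ) (k : ℕ) :
    EqOn (fun x => x ^ k * orthoWeight α ν lam t x) (orthoWeight (α + k) ν lam t) (Ioi 0) := by
  intro x (hx : 0 < x)
  simp only [orthoWeight, Real.rpow_add_natCast hx.ne']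
  ring

include hα hαν hlam ht

theorem integrableOn_pow_mul_orthoWeight (k : ℕ) :
    IntegrableOn (fun x => x ^ k * orthoWeight α ν lam t x) (Ioi 0) := by
  have hk : -1 < α + k := by linarith [k.cast_nonneg (α := ℝ)]
  have hkν : -1 < α + k + ν := by linarith [k.cast_nonneg (α := ℝ)]
  rw [integrableOn_congr_fun (pow_mul_orthoWeight α ν lam t k) measurableSet_Ioi]
  exact integrableOn_orthoWeight hk hkν hlam ht

theorem integral_pow_mul_orthoWeight (k : ℕ) :
    ∫ x in Ioi 0, x ^ k * orthoWeight α ν lam t x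
      = ∫ y in Ioi 0, y ^ ν * Real.exp (-y) * laguerreKernel (α + k) lam t y := by
  have hk : -1 < α + k := by linarith [k.cast_nonneg (α := ℝ)]
  have hkν : -1 < α + k + ν := by linarith [k.cast_nonneg (α := ℝ)]
  rw [setIntegral_congr_fun measurableSet_Ioi (pow_mul_orthoWeight α ν lam t k)]
  exact integral_orthoWeight hk hkν hlam ht

theorem integrableOn_rpow_mul_exp_neg_mul_laguerreKernel_add_natCast (k : ℕ) :
    IntegrableOn (fun y => y ^ ν * Real.exp (-y) * laguerreKernel (α + k) lam t y) (Ioi 0) := by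
  have hk : -1 < α + k := by linarith [k.cast_nonneg (α := ℝ)]
  have hkν : -1 < α + k + ν := by linarith [k.cast_nonneg (α := ℝ)]
  exact integrableOn_rpow_mul_exp_neg_mul_laguerreKernel hk.le hkν hlam ht

theorem integrableOn_compositionIntegrand (p : ℝ[X]) (m : ℕ) :
    IntegrableOn (compositionIntegrand α ν lam t p m) (Ioi 0) := by
  rw [integrableOn_congr_fun (compositionIntegrand_eq_sum hα ν hlam ht p m) measurableSet_Ioi]
  exact integrable_finsetSum _ fun k _ =>
    (integrableOn_rpow_mul_exp_neg_mul_laguerreKernel_add_natCast hα hαν hlam ht _).const_mul _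

theorem integral_compositionIntegrand (p : ℝ[X]) (m : ℕ) :
    ∫ y in Ioi 0, compositionIntegrand α ν lam t p m y
      = t ^ m * ∫ x in Ioi 0, p.eval x * orthoWeight α ν lam t x * x ^ m := by
  rw [setIntegral_congr_fun measurableSet_Ioi (compositionIntegrand_eq_sum hα ν hlam ht p m),
    integral_finsetSum _ fun k _ =>
      (integrableOn_rpow_mul_exp_neg_mul_laguerreKernel_add_natCast hα hαν hlam ht _).const_mul _,
    integral_eval_mul_mul_pow_eq_sum (integrableOn_pow_mul_orthoWeight hα hαν hlam ht),
    Finset.mul_sum]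
  refine Finset.sum_congr rfl fun k _ => ?_
  rw [integral_const_mul, integral_pow_mul_orthoWeight hα hαν hlam ht, mul_assoc]

theorem orthogonalToLower_iff_compositionallyOrthogonal (n : ℕ) (p : ℝ[X]) :
    OrthogonalToLower α ν lam t n p ↔ CompositionallyOrthogonal α ν lam t n p := by
  refine forall₂_congr fun m _ => ?_
  rw [integral_compositionIntegrand hα hαν hlam ht, mul_eq_zero_iff_left (pow_ne_zero m ht.ne')]
  exact and_congr_left' (iff_of_true
    (integrable_eval_mul_mul_pow (integrableOn_pow_mul_orthoWeight hα hαν hlam ht) p m)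
    (integrableOn_compositionIntegrand hα hαν hlam ht p m))

theorem IsOrthonormalSeq.orthogonalToLower {P : ℕ → ℝ[X]} (hP : IsOrthonormalSeq α ν lam t P)
    (n : ℕ) : OrthogonalToLower α ν lam t n (P n) := by
  intro m hm
  have hw : ∀ k : ℕ, Integrable (fun x => x ^ k * orthoWeight α ν lam t x)
      (volume.restrict (Ioi 0)) := integrableOn_pow_mul_orthoWeight hα hαν hlam ht
  refine ⟨integrable_eval_mul_mul_pow hw (P n) m, ?_⟩
  let S : Polynomial.Sequence ℝ := ⟨P, hP.degree_eq⟩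
  have hunit : ∀ i < n, IsUnit (S i).leadingCoeff := fun i _ =>
    (Polynomial.leadingCoeff_ne_zero.2 (S.ne_zero i)).isUnit
  have hzero : ∀ i < n, momentFunctional hw (P n * S i) = 0 := fun i hi => by
    simp only [momentFunctional_apply, Polynomial.eval_mul]
    exact (hP.integral_eq n i).trans (if_neg hi.ne)
  have hXm : momentFunctional hw (P n * Polynomial.X ^ m) = 0 :=
    linearMap_eq_zero_of_degree_lt S hunit (momentFunctional hw ∘ₗ LinearMap.mulLeft ℝ (P n)) hzero
      (by simpa using hm)
  simpa only [momentFunctional_apply, Polynomial.eval_mul, Polynomial.eval_pow, Polynomial.eval_X,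
    mul_right_comm] using hXm

end CompositionOrthogonality

theorem theorem5_general (α ν lam t : ℝ) (hα : -1 < α) (hαν : -1 < α + ν) (hlam : 0 ≤ lam)
    (ht : 0 < t) (P : ℕ → ℝ[X]) (hP : IsOrthonormalSeq α ν lam t P) :
    (∀ n : ℕ, CompositionallyOrthogonal α ν lam t n (P n)) ∧
    (∀ (n : ℕ) (p : ℝ[X]),
      OrthogonalToLower α ν lam t n p ↔ CompositionallyOrthogonal α ν lam t n p) := by
  have hiff := orthogonalToLower_iff_compositionallyOrthogonal hα hαν hlam ht
  exact ⟨fun n => (hiff n (P n)).1 (hP.orthogonalToLower hα hαν hlam ht n), hiff⟩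

theorem theorem5 (α ν lam t : ℝ) (hα : -1 < α) (hν : 0 ≤ ν) (hlam : 0 ≤ lam) (ht : 0 < t)
    (P : ℕ → ℝ[X]) (hP : IsOrthonormalSeq α ν lam t P) :
    (∀ n : ℕ, 1 ≤ n → CompositionallyOrthogonal α ν lam t n (P n)) ∧
    (∀ n : ℕ, 1 ≤ n → ∀ p : ℝ[X], p.degree = (n : WithBot ℕ) →
      (OrthogonalToLower α ν lam t n p ↔ CompositionallyOrthogonal α ν lam t n p)) := by
  obtain ⟨hseq, hiff⟩ := theorem5_general α ν lam t hα (by linarith) hlam ht P hP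
  exact ⟨fun n _ => hseq n, fun n _ p _ => hiff n p⟩
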